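/- Theorem. A simple mixed graph on a finite vertex set $V$ has at most one edge between any two distinct vertices, of type $v-w$, $v\to w$, $v\leftarrow w$ or $v\leftrightarrow w$, and no loops; it is bi-directed if all its edges are of type $\leftrightarrow$. It is ancestral if (i) it has no directed cycle, (ii) no edge has an arrowhead at an endpoint of an undirected edge, and (iii) $v\leftrightarrow w$ implies that $v$ is not an ancestor of $w$ (every vertex being an ancestor of itself). A path (with distinct vertices) between $v$ and $w$ is $m$-connecting given $C\subseteq V\setminus\{v,w\}$ if every non-endpoint vertex at which both adjoining edges of the path have arrowheads (a collider) is an ancestor of an element of $C$, and every other non-endpoint vertex is not in $C$; $v$ and $w$ are $m$-separated given $C$ if there is no such path, and sets $A,B$ are $m$-separated given $C$ if all $v\in A$, $w\in B$ are. Two graphs on $V$ are Markov equivalent if the same triples of pairwise disjoint sets $(A,B,C)$ with $A,B\neq\emptyset$ have $A$ and $B$ $m$-separated given $C$. An ancestral graph is maximal if any two distinct non-adjacent vertices $v,w$ are $m$-separated given some $C\subseteq V\setminus\{v,w\}$. A minimally oriented graph for a bi-directed graph $G$ is a maximal ancestral graph $G^{\min}$ on $V$, Markov equivalent to $G$, whose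 number of arrowheads (number of directed edges plus twice the number of bi-directed edges) is minimal among all maximal ancestral graphs that are Markov equivalent to $G$. Let $G$ be a bi-directed graph on $V$, let $G^{\min}$ be a minimally oriented graph for $G$, and let $S\in\mathbb{R}^{V\times V}$ be symmetric positive definite. Let $\hat\Sigma\in\mathbb{R}^{V\times V}$ be a solution to the likelihood equations, i.e. $\hat\Sigma$ is symmetric positive definite, $\hat\Sigma_{uw}=0$ whenever $u\ne w$ and $u\leftrightarrow w\notin G$, and $$(\hat\Sigma^{-1})_{uw}=(\hat\Sigma^{-1}S\hat\Sigma^{-1})_{uw}\quad\text{for all } u,w\in V \text{ with } u=w \text{ or } u\leftrightarrow w\in G.$$ Let $v\in V$ be such that there is no $w$ with $v\leftrightarrow w\in G^{\min}$, and let $P=\mathrm{pa}(v)=\{w\in V: w\to v\in G^{\min}\}$. Then the regression coefficients for $v$ given $P$ are $$\hat\Sigma_{v\times P}\,(\hat\Sigma_{P\times P})^{-1}=S_{v\times P}\,(S_{P\times P})^{-1},$$ and the conditional variance for $v$ given $P$ is $$\hat\Sigma_{vv}-\hat\Sigma_{v\times P}\,(\hat\Sigma_{P\times P})^{-1}\hat\Sigma_{P\times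 v}=S_{vv}-S_{v\times P}\,(S_{P\times P})^{-1}S_{P\times v}.$$ If $P=\emptyset$, the first identity is void and the second reads $\hat\Sigma_{vv}=S_{vv}$. -/

import Mathlib

open scoped Matrix

/-- The possible edges between an ordered pair `(v, w)`: no edge, `v - w`, `v → w`, `v ← w`,
`v ↔ w`. -/
inductive MixedEdge where
  | none
  | line
  | right
  | left
  | bidir
  deriving DecidableEq

/-- A simple mixed graph on the vertex set `V`, given by its edge map. -/
structure SimpleMixedGraph (V : Type*) where
  E : V → V → MixedEdge
  loopless : ∀ v, E v v = MixedEdge.none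
  line_symm : ∀ v w, E v w = MixedEdge.line → E w v = MixedEdge.line
  bidir_symm : ∀ v w, E v w = MixedEdge.bidir → E w v = MixedEdge.bidir
  right_iff_left : ∀ v w, E v w = MixedEdge.right ↔ E w v = MixedEdge.left

namespace SimpleMixedGraph

variable {V : Type*}

/-- Two vertices are adjacent if there is some edge between them. -/
def Adj (G : SimpleMixedGraph V) (v w : V) : Prop :=
  G.E v w ≠ MixedEdge.none

theorem adj_symm (G : SimpleMixedGraph V) {v w : V} (h : G.Adj v w) : G.Adj w v := by
  have h1 := G.line_symm v w
  have h2 := G.bidir_symm v w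
  have h3 := G.right_iff_left v w
  have h4 := G.right_iff_left w v
  unfold Adj at *
  cases hvw : G.E v w <;> simp_all

/-- The skeleton of a simple mixed graph, as an undirected simple graph. Its (vertex) paths are
the paths of the mixed graph. -/
def skeleton (G : SimpleMixedGraph V) : SimpleGraph V where
  Adj := G.Adj
  symm := ⟨fun _ _ h => G.adj_symm h⟩
  loopless := ⟨fun v h => h (G.loopless v)⟩

/-- The edge between `v` and `w` has an arrowhead at `v`, i.e. it is `v ← w` or `v ↔ w`. -/
def ArrowheadAt (G : SimpleMixedGraph V) (v w : V) : Prop :=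
  G.E v w = MixedEdge.left ∨ G.E v w = MixedEdge.bidir

/-- `v` is an ancestor of `w`: `v = w` or there is a directed path `v → ⋯ → w`. -/
def IsAncestor (G : SimpleMixedGraph V) (v w : V) : Prop :=
  Relation.ReflTransGen (fun a b => G.E a b = MixedEdge.right) v w

/-- The set `an(C)` of ancestors of a set of vertices. -/
def ancestors (G : SimpleMixedGraph V) (C : Set V) : Set V :=
  {v | ∃ c ∈ C, G.IsAncestor v c}

/-- A bi-directed graph: all edges are bi-directed. -/
def IsBidirected (G : SimpleMixedGraph V) : Prop :=
  ∀ v w, G.Adj v w → G.E v w = MixedEdge.bidir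

/-- Ancestral graphs. -/
structure IsAncestral (G : SimpleMixedGraph V) : Prop where
  /-- There is no directed cycle. -/
  acyclic : ∀ v w, G.IsAncestor v w → G.E w v ≠ MixedEdge.right
  /-- There are no arrowheads at an endpoint of an undirected edge. -/
  line : ∀ v w, G.E v w = MixedEdge.line →
    ¬ ∃ u, G.E u v = MixedEdge.right ∨ G.E u v = MixedEdge.bidir
  /-- An endpoint of a bi-directed edge is not an ancestor of the other endpoint. -/
  bidir : ∀ v w, G.E v w = MixedEdge.bidir → ¬ G.IsAncestor v w

/-- For consecutive vertices `a, b, c` on a path, `b` is a collider. -/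
def IsCollider (G : SimpleMixedGraph V) (a b c : V) : Prop :=
  G.ArrowheadAt b a ∧ G.ArrowheadAt b c

/-- A path between `v` and `w` (a walk without repeated vertices) is `m`-connecting given `C`:
every non-collider on it is outside `C`, every collider on it is in `an(C)`. The non-endpoint
vertices of the path are the middle vertices of its contiguous triples. -/
def IsMConnecting (G : SimpleMixedGraph V) (C : Set V) {v w : V} (p : G.skeleton.Walk v w) :
    Prop :=
  p.IsPath ∧ ∀ a b c, [a, b, c] <:+: p.support →
    (¬ G.IsCollider a b c → b ∉ C) ∧ (G.IsCollider a b c → b ∈ G.ancestors C)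

/-- Vertices `v` and `w` are `m`-separated given `C`. -/
def MSep (G : SimpleMixedGraph V) (v w : V) (C : Set V) : Prop :=
  ¬ ∃ p : G.skeleton.Walk v w, G.IsMConnecting C p

/-- The vertex sets `A` and `B` are `m`-separated given `C`. -/
def MSepSets (G : SimpleMixedGraph V) (A B C : Set V) : Prop :=
  ∀ v ∈ A, ∀ w ∈ B, G.MSep v w C

/-- A maximal ancestral graph: an ancestral graph in which any two distinct non-adjacent vertices
are `m`-separated given some set of other vertices. -/
def IsMaximalAncestral (G : SimpleMixedGraph V) : Prop :=
  G.IsAncestral ∧ ∀ v w, v ≠ w → ¬ G.Adj v w → ∃ C : Set V, v ∉ C ∧ w ∉ C ∧ G.MSep v w C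

/-- Two graphs on the same vertex set are Markov equivalent: their global Markov properties state
the same independences `A ⊥ B | C`. -/
def MarkovEquiv (G H : SimpleMixedGraph V) : Prop :=
  ∀ A B C : Set V, A.Nonempty → B.Nonempty → Disjoint A B → Disjoint A C → Disjoint B C →
    (G.MSepSets A B C ↔ H.MSepSets A B C)

/-- The number of arrowheads: the number of directed edges plus twice the number of
bi-directed edges. -/
noncomputable def arr (G : SimpleMixedGraph V) : ℕ :=
  {e : V × V | G.E e.1 e.2 = MixedEdge.right}.ncard +
    2 * {e : Sym2 V | ∃ v w, e = s(v, w) ∧ G.E v w = MixedEdge.bidir}.ncard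

/-- `Gmin` is a minimally oriented graph for `G`. -/
structure IsMinimallyOriented (Gmin G : SimpleMixedGraph V) : Prop where
  maximalAncestral : Gmin.IsMaximalAncestral
  markovEquiv : G.MarkovEquiv Gmin
  arr_le : ∀ H : SimpleMixedGraph V, H.IsMaximalAncestral → G.MarkovEquiv H → Gmin.arr ≤ H.arr

/-- The set of parents of `v`. -/
def pa [Fintype V] (G : SimpleMixedGraph V) (v : V) : Finset V :=
  {w | G.E w v = MixedEdge.right}

/-- The cone `P(G)` of symmetric positive definite matrices with vanishing off-diagonal entries at
the pairs that are not joined by a bi-directed edge. -/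
def covCone (G : SimpleMixedGraph V) : Set (Matrix V V ℝ) :=
  {M | M.PosDef ∧ ∀ v w, v ≠ w → G.E v w ≠ MixedEdge.bidir → M v w = 0}

/-- `M` is a solution to the likelihood equations of the covariance graph model of `G`, for the
empirical covariance matrix `S`. -/
def SolvesLikelihood [Fintype V] [DecidableEq V] (G : SimpleMixedGraph V) (S M : Matrix V V ℝ) :
    Prop :=
  M ∈ G.covCone ∧
    ∀ v w, v = w ∨ G.E v w = MixedEdge.bidir → M⁻¹ v w = (M⁻¹ * S * M⁻¹) v w

end SimpleMixedGraph

/-- The row vector `M_{v × A} (M_{A × A})⁻¹` of regression coefficients for `v` given `A` under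
the covariance matrix `M`. -/
noncomputable def regressionCoeff {V : Type*} [DecidableEq V] (M : Matrix V V ℝ) (v : V)
    (A : Finset V) : A → ℝ :=
  (fun a : A => M v a) ᵥ* (M.submatrix (fun a : A => (a : V)) (fun a : A => (a : V)))⁻¹

/-- The conditional variance `M_{vv} - M_{v × A} (M_{A × A})⁻¹ M_{A × v}` of `v` given `A` under
the covariance matrix `M`. -/
noncomputable def conditionalVariance {V : Type*} [DecidableEq V] (M : Matrix V V ℝ) (v : V)
    (A : Finset V) : ℝ :=
  M v v - regressionCoeff M v A ⬝ᵥ (fun a : A => M a v)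

/-!
Only two graphical facts about `Gmin` matter. In a bi-directed graph, non-adjacent vertices are
`m`-separated given the empty set, because every path with at least one inner vertex has a
collider. Hence `G` and `Gmin` have the same skeleton (`adj_iff_of_markovEquiv`), and in `Gmin` the
middle vertex of an unshielded triple must be a collider. So if the edge between `v` and `w` in
`Gmin` has a tail at `v`, every vertex equal or adjacent to `v` is equal or adjacent to `w`
(`near_of_not_arrowheadAt`). These facts hold for every maximal ancestral graph that is Markov
equivalent to `G`.

On the algebraic side, the likelihood equations say that `N = Σ⁻¹ S Σ⁻¹ - Σ⁻¹` vanishes on the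
diagonal and on the edges of `G`, while `S - Σ = Σ N Σ`. Let `β` be the regression coefficients for
`v` given `P` under `Σ`, and let `r = Σ_{v × V} - β Σ_{P × V}` be the residual covariances. Then `r`
vanishes on `P`, and also off the closed neighbourhood of `v`, because each parent has its closed
neighbourhood inside that of `v`. If `v` has no bi-directed edges, a vertex `i` with `r i ≠ 0` is
therefore `v` itself or joined to `v` by an edge with a tail at `v`, so `i` is equal or adjacent to
everything near `v`. It follows that `(r N Σ)_q = 0` for `q ∈ P ∪ {v}`: the residual has the same
covariance with `P ∪ {v}` under `S` as under `Σ`. For `q ∈ P` these are the normal equations that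
characterise `β` under `S`, and for `q = v` this is the equality of the conditional variances.
-/

namespace SimpleMixedGraph

variable {V : Type*}

/-- `w` lies in the closed neighbourhood of `v`: the two vertices are equal or adjacent. -/
def Near (G : SimpleMixedGraph V) (v w : V) : Prop :=
  v = w ∨ G.Adj v w

theorem Near.symm {G : SimpleMixedGraph V} {v w : V} (h : G.Near v w) : G.Near w v :=
  h.imp Eq.symm G.adj_symm

theorem markovEquiv_mSep {G H : SimpleMixedGraph V} (h : G.MarkovEquiv H) {v w : V} {C : Set V}
    (hvw : v ≠ w) (hv : v ∉ C) (hw : w ∉ C) : G.MSep v w C ↔ H.MSep v w C := by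
  have := h {v} {w} C (Set.singleton_nonempty v) (Set.singleton_nonempty w)
    (by simpa using hvw) (by simpa using hv) (by simpa using hw)
  simpa [MSepSets] using this

theorem not_mSep_of_adj (G : SimpleMixedGraph V) {v w : V} (h : G.Adj v w) (C : Set V) :
    ¬ G.MSep v w C := by
  have hne : v ≠ w := fun e => h (e ▸ G.loopless v)
  have h' : G.skeleton.Adj v w := h
  refine not_not.mpr ⟨h'.toWalk, by simpa using hne, fun a b c hs => ?_⟩
  have := hs.length_le
  simp at this

/-- A path of length two whose middle vertex is not a collider is `m`-connecting given `∅`. -/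
theorem not_mSep_empty_of_not_isCollider (G : SimpleMixedGraph V) {u v w : V} (huw : u ≠ w)
    (huv : G.Adj u v) (hvw : G.Adj v w) (h : ¬ G.IsCollider u v w) : ¬ G.MSep u w ∅ := by
  have huv' : G.skeleton.Adj u v := huv
  have hvw' : G.skeleton.Adj v w := hvw
  refine not_not.mpr ⟨.cons huv' (.cons hvw' .nil), ?_, fun a b c hs => ?_⟩
  · simp [SimpleGraph.Walk.isPath_def, huw, huv'.ne, hvw'.ne]
  · have hs' : [a, b, c] = [u, v, w] := by
      simpa using hs.eq_of_length (by simp)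
    simp only [List.cons.injEq, and_true] at hs'
    obtain ⟨rfl, rfl, rfl⟩ := hs'
    exact ⟨fun _ => id, fun hc => absurd hc h⟩

/-- On a path of a bi-directed graph every inner vertex is a collider, and no vertex is an ancestor
of the empty set. -/
theorem IsBidirected.mSep_empty {G : SimpleMixedGraph V} (hG : G.IsBidirected) {v w : V}
    (hne : v ≠ w) (h : ¬ G.Adj v w) : G.MSep v w ∅ := by
  rintro ⟨p, -, hp⟩
  match p with
  | .nil => exact hne rfl
  | .cons h₁ .nil => exact h h₁
  | .cons (v := a) h₁ (.cons (v := b) h₂ q) =>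
    have hs : [v, a, b] <:+: (SimpleGraph.Walk.cons h₁ (.cons h₂ q)).support := by
      rw [SimpleGraph.Walk.support_cons, SimpleGraph.Walk.support_cons,
        ← SimpleGraph.Walk.cons_tail_support q]
      exact ⟨[], q.support.tail, rfl⟩
    obtain ⟨c, hc, -⟩ := (hp v a b hs).2
      ⟨.inr (G.bidir_symm _ _ (hG _ _ h₁)), .inr (hG _ _ h₂)⟩
    exact hc

theorem adj_iff_of_markovEquiv {G H : SimpleMixedGraph V} (hG : G.IsBidirected)
    (hH : H.IsMaximalAncestral) (h : G.MarkovEquiv H) {v w : V} : G.Adj v w ↔ H.Adj v w := by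
  rcases eq_or_ne v w with rfl | hne
  · simp [Adj, G.loopless, H.loopless]
  refine ⟨fun hvw => ?_, fun hvw => ?_⟩
  · by_contra hn
    obtain ⟨C, hv, hw, hC⟩ := hH.2 v w hne hn
    exact G.not_mSep_of_adj hvw C ((markovEquiv_mSep h hne hv hw).2 hC)
  · by_contra hn
    exact H.not_mSep_of_adj hvw ∅ ((markovEquiv_mSep h hne (by simp) (by simp)).1
      (hG.mSep_empty hne hn))

/-- A tail at `v` on an edge between `v` and `w` forces the closed neighbourhood of `v` to be
contained in that of `w`. -/
theorem near_of_not_arrowheadAt {G H : SimpleMixedGraph V} (hG : G.IsBidirected)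
    (hH : H.IsMaximalAncestral) (h : G.MarkovEquiv H) {u v w : V} (hvw : H.Adj v w)
    (ht : ¬ H.ArrowheadAt v w) (huv : G.Near u v) : G.Near u w := by
  have hadj {a b : V} : G.Adj a b ↔ H.Adj a b := adj_iff_of_markovEquiv hG hH h
  rcases huv with rfl | huv
  · exact .inr (hadj.2 hvw)
  by_contra hn
  obtain ⟨hne, hna⟩ := not_or.1 hn
  exact H.not_mSep_empty_of_not_isCollider hne (hadj.1 huv) hvw (fun hc => ht hc.2)
    ((markovEquiv_mSep h hne (by simp) (by simp)).1 (hG.mSep_empty hne hna))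

theorem eq_zero_of_mem_covCone {G : SimpleMixedGraph V} {M : Matrix V V ℝ} (hM : M ∈ G.covCone)
    {v w : V} (h : ¬ G.Near v w) : M v w = 0 := by
  obtain ⟨hne, hna⟩ := not_or.1 h
  refine hM.2 v w hne fun hb => hna ?_
  simp [Adj, hb]

/-- A solution of the likelihood equations differs from `S` by `Σ N Σ`, where `N` vanishes on the
diagonal and on the edges. -/
theorem SolvesLikelihood.exists_eq_add [Fintype V] [DecidableEq V] {G : SimpleMixedGraph V}
    (hG : G.IsBidirected) {S M : Matrix V V ℝ} (h : G.SolvesLikelihood S M) :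
    ∃ N : Matrix V V ℝ, (∀ i j, G.Near i j → N i j = 0) ∧ S = M + M * N * M := by
  have hu : IsUnit M.det := (Matrix.isUnit_iff_isUnit_det M).1 h.1.1.isUnit
  refine ⟨M⁻¹ * S * M⁻¹ - M⁻¹, fun i j hij => ?_, ?_⟩
  · rw [Matrix.sub_apply, ← h.2 i j (hij.imp_right (hG i j)), sub_self]
  · simp only [Matrix.mul_sub, Matrix.sub_mul, ← Matrix.mul_assoc, Matrix.mul_nonsing_inv _ hu,
      Matrix.one_mul]
    rw [Matrix.mul_assoc S, Matrix.nonsing_inv_mul _ hu, Matrix.mul_one, add_sub_cancel]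

end SimpleMixedGraph

/-- Regression coefficients are characterised by the normal equations. -/
theorem eq_regressionCoeff_iff {V : Type*} [DecidableEq V] {M : Matrix V V ℝ}
    (hM : M.PosDef) (v : V) (A : Finset V) (b : A → ℝ) :
    b = regressionCoeff M v A ↔ ∀ q : A, ∑ p : A, b p * M p q = M v q := by
  set B := M.submatrix (fun a : A => (a : V)) (fun a : A => (a : V)) with hB
  have hu : IsUnit B.det :=
    (Matrix.isUnit_iff_isUnit_det B).1 (hM.submatrix Subtype.val_injective).isUnit
  have hb : (∀ q : A, ∑ p : A, b p * M p q = M v q) ↔ b ᵥ* B = fun a : A => M v a :=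
    funext_iff.symm
  rw [hb, regressionCoeff, ← hB]
  constructor
  · rintro rfl
    rw [Matrix.vecMul_vecMul, Matrix.nonsing_inv_mul _ hu, Matrix.vecMul_one]
  · intro h
    rw [← h, Matrix.vecMul_vecMul, Matrix.mul_nonsing_inv _ hu, Matrix.vecMul_one]

theorem mainTheorem7 {V : Type*} [Fintype V] [DecidableEq V]
    (G Gmin : SimpleMixedGraph V) (hG : G.IsBidirected) (hmin : Gmin.IsMinimallyOriented G)
    (S Sigma : Matrix V V ℝ) (hS : S.PosDef) (hSigma : G.SolvesLikelihood S Sigma)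
    (v : V) (hv : ¬ ∃ w, Gmin.E v w = MixedEdge.bidir) :
    regressionCoeff Sigma v (Gmin.pa v) = regressionCoeff S v (Gmin.pa v) ∧
      conditionalVariance Sigma v (Gmin.pa v) = conditionalVariance S v (Gmin.pa v) := by
  have hmax := hmin.maximalAncestral
  have heq := hmin.markovEquiv
  obtain ⟨N, hN, hSN⟩ := hSigma.exists_eq_add hG
  set P := Gmin.pa v with hP
  set β := regressionCoeff Sigma v P with hβ
  have hnormal := (eq_regressionCoeff_iff hSigma.1.1 v P β).1 hβ
  have hparent : ∀ p ∈ P, ∀ j, G.Near j p → G.Near j v := by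
    intro p hp j hj
    have hpv : Gmin.E p v = MixedEdge.right := by simpa [hP, SimpleMixedGraph.pa] using hp
    refine SimpleMixedGraph.near_of_not_arrowheadAt hG hmax heq ?_ ?_ hj <;>
      simp [SimpleMixedGraph.Adj, SimpleMixedGraph.ArrowheadAt, hpv]
  set r : V → ℝ := fun i => Sigma v i - ∑ p : P, β p * Sigma p i with hr
  have hrsupp : ∀ i, r i ≠ 0 → ∀ j, G.Near j v → G.Near j i := by
    intro i hi j hj
    have hiP : i ∉ P := fun h => hi (sub_eq_zero.2 (hnormal ⟨i, h⟩).symm)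
    have hvi : G.Near v i := by
      by_contra hn
      refine hi ?_
      have h0 : ∀ p : P, β p * Sigma p i = 0 := fun p => by
        rw [SimpleMixedGraph.eq_zero_of_mem_covCone hSigma.1
          (fun h => hn (hparent p p.2 i h.symm).symm), mul_zero]
      simp [hr, h0, SimpleMixedGraph.eq_zero_of_mem_covCone hSigma.1 hn]
    rcases hvi with rfl | hvi
    · exact hj
    refine SimpleMixedGraph.near_of_not_arrowheadAt hG hmax heq
      ((SimpleMixedGraph.adj_iff_of_markovEquiv hG hmax heq).1 hvi) ?_ hj
    rintro (h | h)
    · exact hiP (by simpa [hP, SimpleMixedGraph.pa] using (Gmin.right_iff_left i v).2 h)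
    · exact hv ⟨i, h⟩
  -- The residual has the same covariance with `P ∪ {v}` under `S` as under `Sigma`.
  have hres : ∀ q, (∀ j, G.Near j q → G.Near j v) →
      S v q - ∑ p : P, β p * S p q = r q := by
    intro q hq
    have hzero : ∑ i, r i * (N * Sigma) i q = 0 := by
      refine Finset.sum_eq_zero fun i _ => ?_
      by_cases hi : r i = 0
      · rw [hi, zero_mul]
      rw [Matrix.mul_apply, Finset.sum_eq_zero, mul_zero]
      intro j _
      by_cases hj : G.Near j q
      · rw [hN i j (hrsupp i hi j (hq j hj)).symm, zero_mul]
      · rw [SimpleMixedGraph.eq_zero_of_mem_covCone hSigma.1 hj, mul_zero]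
    have hS' : ∀ a, S a q = Sigma a q + ∑ i, Sigma a i * (N * Sigma) i q := fun a => by
      rw [hSN, Matrix.add_apply, Matrix.mul_assoc, Matrix.mul_apply]
    have hexpand : ∑ i, r i * (N * Sigma) i q = ∑ i, Sigma v i * (N * Sigma) i q -
        ∑ p : P, β p * ∑ i, Sigma p i * (N * Sigma) i q := by
      simp only [hr, sub_mul, Finset.sum_sub_distrib, Finset.sum_mul, Finset.mul_sum, mul_assoc]
      rw [Finset.sum_comm]
    simp only [hS', mul_add, Finset.sum_add_distrib, hr]
    linarith
  have hcoeff : β = regressionCoeff S v P := by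
    refine (eq_regressionCoeff_iff hS v P β).2 fun q => ?_
    have hq := hres q (hparent q q.2)
    have hrq : r q = 0 := sub_eq_zero.2 (hnormal q).symm
    linarith
  refine ⟨hcoeff, ?_⟩
  rw [conditionalVariance, conditionalVariance, ← hcoeff, ← hβ]
  exact (hres v fun _ => id).symm
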